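/- Let $\mathbb{K}$ be an infinite field, $d\in\mathbb{N}$ and $\mathbf{m}=(m_1,\dots,m_d)\in\mathbb{Z}_{\ge 0}^d$. Write $P(d,\mathbf{m})$ for the polynomial ring over $\mathbb{K}$ in the variables $x_{i,j}$, $1\le i\le d$, $1\le j\le m_i$; the variable $x_{i,j}$ has color $i$. Put $\mathbf{m}+\mathbf{1}=(m_1+1,\dots,m_d+1)$. A monomial is color-squarefree if it is squarefree and divisible by at most one variable of each color. Let $U$ be a color-squarefree shifted order ideal of $P(d,\mathbf{m})$, that is, a set of color-squarefree monomials that is closed under taking divisors and such that $x_{k,\ell}u\in U$ implies $x_{k,j}u\in U$ for all $\ell\le j\le m_k$. Let $I(U)\subseteq P(d,\mathbf{m})$ be the ideal generated by all monomials of $P(d,\mathbf{m})$ not in $U$. For $u=x_{i_1,j_1}\cdots x_{i_s,j_s}\in U$ with $i_1<\dots<i_s$, let $F_d(u)=\{j_1^{(i_1)},\dots,j_s^{(i_s)}\}\cup\{(m_i+1)^{(i)} : i\in\{1,\dots,d\}\setminus\{i_1,\dots,i_s\}\}$, and let $\Delta_{\mathrm{bal}}(U)$ be the simplicial complex on the vertices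 $j^{(i)}$ ($1\le i\le d$, $1\le j\le m_i+1$) whose faces are the subsets of the sets $F_d(u)$, $u\in U$. Let $I_{\Delta_{\mathrm{bal}}(U)}\subseteq P(d,\mathbf{m}+\mathbf{1})$ be its Stanley-Reisner ideal, generated by the monomials $\prod_{j^{(i)}\in F}x_{i,j}$ for the sets $F$ of vertices that are not faces. Let $\prec$ be a total order on the variables of $P(d,\mathbf{m}+\mathbf{1})$ with $x_{i,m_i+1}\prec x_{i,m_i}\prec\dots\prec x_{i,1}$ for all $i$, and form initial ideals $\mathrm{in}_\prec$ with respect to the degree reverse lexicographic order induced by $\prec$. The group $GL_{m_1+1}(\mathbb{K})\times\dots\times GL_{m_d+1}(\mathbb{K})$ acts on $P(d,\mathbf{m}+\mathbf{1})$ by linear substitutions within each color. An ideal $J$ is the multigraded generic initial ideal $\mathrm{gin}_\prec(I)$ of $I$ if there are nonempty Zariski open sets $W_i\subseteq GL_{m_i+1}(\mathbb{K})$ with $\mathrm{in}_\prec(\varphi(I))=J$ for all $\varphi\in W_1\times\dots\times W_d$. Then the multigraded generic initial ideal of $I_{\Delta_{\mathrm{bal}}(U)}$ exists, is unique, and $$\mathrm{gin}_\prec\big(I_{\Delta_{\mathrm{bal}}(U)}\big)=I(U)\,P(d,\mathbf{m}+\mathbf{1}).$$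 In particular, it is strongly color-stable: it is a monomial ideal, and if it contains a monomial $x_{k,\ell}u$, then it contains $x_{k,j}u$ for all $j<\ell$. -/

import Mathlib

noncomputable section

namespace BalancedSqueezed

open MvPolynomial

/-- The index set of the variables of `P(d, m)`: the pair `⟨i, j⟩` stands for the `j`-th variable
of color `i`. Colors and positions are counted from `0`, so the variable `x_{i+1, j+1}` is `⟨i, j⟩`.
The polynomial ring `P(d, m)` over `K` is `MvPolynomial (Var m) K`. -/
abbrev Var {d : ℕ} (m : Fin d → ℕ) : Type := Σ i : Fin d, Fin (m i)

/-- The vector `m + (1, …, 1)`. -/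
abbrev addOne {d : ℕ} (m : Fin d → ℕ) : Fin d → ℕ := fun i => m i + 1

/-- A variable of `P(d, m)`, considered as a variable of `P(d, m + (1, …, 1))`. -/
def embVar {d : ℕ} {m : Fin d → ℕ} (v : Var m) : Var (addOne m) :=
  ⟨v.1, v.2.castSucc⟩

/-- The additional (last) variable of color `i` of `P(d, m + (1, …, 1))`. -/
def lastVar {d : ℕ} (m : Fin d → ℕ) (i : Fin d) : Var (addOne m) :=
  ⟨i, Fin.last (m i)⟩

/-! ### Order ideals of monomials

A monomial is given by its exponent vector; divisibility of monomials is the order of exponent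
vectors. -/

/-- A monomial is color-squarefree if it is squarefree and divisible by at most one variable of
each color. -/
def IsColorSquarefree {d : ℕ} {m : Fin d → ℕ} (u : Var m →₀ ℕ) : Prop :=
  (∀ v, u v ≤ 1) ∧ ∀ v ∈ u.support, ∀ w ∈ u.support, v.1 = w.1 → v = w

/-- A color-squarefree order ideal that is shifted: a set of color-squarefree monomials, closed
under taking divisors, which with each monomial `x_{k,l} u` also contains `x_{k,j} u` for all
`j ≥ l`. -/
structure IsColorSquarefreeShifted {d : ℕ} {m : Fin d → ℕ} (U : Set (Var m →₀ ℕ)) : Prop where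
  colorSquarefree : ∀ u ∈ U, IsColorSquarefree u
  closed_under_divisors : ∀ u ∈ U, ∀ v, v ≤ u → v ∈ U
  shifted : ∀ (u : Var m →₀ ℕ) (k : Fin d) (l j : Fin (m k)), l ≤ j →
    u + Finsupp.single ⟨k, l⟩ 1 ∈ U → u + Finsupp.single ⟨k, j⟩ 1 ∈ U

/-- The ideal `I(U)` of `P(d, m)`, generated by the monomials that are not in `U`. -/
def orderIdealIdeal (K : Type*) [Field K] {d : ℕ} {m : Fin d → ℕ} (U : Set (Var m →₀ ℕ)) :
    Ideal (MvPolynomial (Var m) K) :=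
  Ideal.span ((fun u => monomial u (1 : K)) '' Uᶜ)

/-- The extension ideal `I · P(d, m + (1, …, 1))` of an ideal `I` of `P(d, m)`. -/
def extend {K : Type*} [Field K] {d : ℕ} {m : Fin d → ℕ} (I : Ideal (MvPolynomial (Var m) K)) :
    Ideal (MvPolynomial (Var (addOne m)) K) :=
  I.map (rename embVar : MvPolynomial (Var m) K →ₐ[K] MvPolynomial (Var (addOne m)) K)

/-! ### The balanced squeezed complex

A (finite, abstract) simplicial complex on a finite vertex set `V` is a collection of subsets of
`V` that is closed under taking subsets, that is, a `LowerSet (Finset V)`. -/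

/-- The facet `F_d(u)`: the vertices of the variables dividing `u`, together with the last vertex
of each color that does not occur in `u`. -/
def facet {d : ℕ} {m : Fin d → ℕ} (u : Var m →₀ ℕ) : Finset (Var (addOne m)) :=
  u.support.image embVar ∪
    (Finset.univ.filter fun i : Fin d => ∀ j : Fin (m i), u ⟨i, j⟩ = 0).image (lastVar m)

/-- The complex `Δ_bal(U)`, generated by the faces `F_d(u)` for `u ∈ U`. -/
def balancedComplex {d : ℕ} {m : Fin d → ℕ} (U : Set (Var m →₀ ℕ)) :
    LowerSet (Finset (Var (addOne m))) :=
  lowerClosure (facet '' U)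

/-- The Stanley-Reisner ideal of a simplicial complex: it is generated by the squarefree monomials
whose supports are not faces. -/
def stanleyReisnerIdeal (K : Type*) [Field K] {V : Type*} (Δ : LowerSet (Finset V)) :
    Ideal (MvPolynomial V K) :=
  Ideal.span {f | ∃ F : Finset V, F ∉ Δ ∧ f = ∏ v ∈ F, X v}

/-! ### Initial ideals with respect to the reverse lexicographic order -/

/-- The (degree) reverse lexicographic order on monomials that is induced by the order `prec` on
the variables: `RevLexLT prec a b` says that `a` is smaller than `b`, that is, `a` has smaller
degree, or both have the same degree and, at the smallest variable where the exponents differ,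
`a` has the larger exponent. -/
def RevLexLT {V : Type*} (prec : V → V → Prop) (a b : V →₀ ℕ) : Prop :=
  a.degree < b.degree ∨
    (a.degree = b.degree ∧ ∃ v, b v < a v ∧ ∀ w, prec w v → a w = b w)

/-- `a` is the exponent of the initial (that is, largest) monomial of `f`. -/
def IsInitialExponent {K : Type*} [Field K] {V : Type*} (prec : V → V → Prop)
    (f : MvPolynomial V K) (a : V →₀ ℕ) : Prop :=
  a ∈ f.support ∧ ∀ b ∈ f.support, b ≠ a → RevLexLT prec b a

/-- The initial ideal: the ideal generated by the initial monomials of the nonzero elements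
of `I`. -/
def initialIdeal {K : Type*} [Field K] {V : Type*} (prec : V → V → Prop)
    (I : Ideal (MvPolynomial V K)) : Ideal (MvPolynomial V K) :=
  Ideal.span {p | ∃ f ∈ I, ∃ a, IsInitialExponent prec f a ∧ p = monomial a (1 : K)}

/-! ### Multigraded generic initial ideals -/

/-- The `ℤ^d`-graded automorphism of `P(d, n)` given by `g ∈ GL_{n_1}(K) × ⋯ × GL_{n_d}(K)`: it
maps `x_{j,i}` to `∑_k a_{k,i} x_{j,k}`, where `(a_{k,l})` is the matrix `g_j`. -/
def colorAction {K : Type*} [Field K] {d : ℕ} {n : Fin d → ℕ}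
    (g : ∀ i, GL (Fin (n i)) K) : MvPolynomial (Var n) K →ₐ[K] MvPolynomial (Var n) K :=
  aeval fun v => ∑ k : Fin (n v.1), C ((g v.1 : Matrix (Fin (n v.1)) (Fin (n v.1)) K) k v.2) *
    X (⟨v.1, k⟩ : Var n)

/-- Zariski open subsets of `GL_n(K)`: unions of nonvanishing loci of polynomials in the matrix
entries. -/
def IsZariskiOpen {K : Type*} [Field K] {n : ℕ} (W : Set (GL (Fin n) K)) : Prop :=
  ∃ S : Set (MvPolynomial (Fin n × Fin n) K),
    W = {g : GL (Fin n) K | ∃ p ∈ S, eval (fun e => (g : Matrix (Fin n) (Fin n) K) e.1 e.2) p ≠ 0}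

/-- `J` is the multigraded generic initial ideal of `I` with respect to `prec`: there are nonempty
Zariski open sets `W_i ⊆ GL_{n_i}(K)` such that the initial ideal of `φ(I)` is `J` for all
`φ ∈ W_1 × ⋯ × W_d`. -/
def IsMultigradedGin {K : Type*} [Field K] {d : ℕ} {n : Fin d → ℕ}
    (prec : Var n → Var n → Prop) (I J : Ideal (MvPolynomial (Var n) K)) : Prop :=
  ∃ W : ∀ i, Set (GL (Fin (n i)) K), (∀ i, IsZariskiOpen (W i) ∧ (W i).Nonempty) ∧
    ∀ g : ∀ i, GL (Fin (n i)) K, (∀ i, g i ∈ W i) →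
      initialIdeal prec (I.map (colorAction g)) = J

/-- A monomial ideal is strongly color-stable if with each monomial `x_{k,l} u` it contains
`x_{k,j} u` for all `j < l`. -/
def IsStronglyColorStable {K : Type*} [Field K] {d : ℕ} {n : Fin d → ℕ}
    (I : Ideal (MvPolynomial (Var n) K)) : Prop :=
  (∃ S : Set (Var n →₀ ℕ), I = Ideal.span ((fun u => monomial u (1 : K)) '' S)) ∧
    ∀ (u : Var n →₀ ℕ) (k : Fin d) (j l : Fin (n k)), j < l →
      monomial (u + Finsupp.single ⟨k, l⟩ 1) (1 : K) ∈ I →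
        monomial (u + Finsupp.single ⟨k, j⟩ 1) (1 : K) ∈ I

end BalancedSqueezed

end

open BalancedSqueezed

/-!
The variable `x_{i, m_i + 1}` plays the role of a dehomogenizing coordinate of color `i`. Encode the
elements of `U` by tuples `F` with `F i ∈ {1, …, m_i + 1}`, where the last value stands for a color
that does not occur. As `U` is shifted and closed under divisors, these tuples form an upper set `T`
of the product order (`tupleMonomial_mem_of_le`), and the facets of the complex are the graphs of
the tuples in `T`. Since each face has at most one vertex of each color, the Stanley-Reisner ideal
is the multigraded vanishing ideal of the points whose component of color `i` is the `F i`-th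
coordinate vector, `F ∈ T`. After a coordinate change by `g`, the coordinate vectors become the
columns of `A i = (g_i⁻¹)ᵀ` (`mem_map_colorAction_stanleyReisnerIdeal_iff`).

The open sets are given by the nonvanishing of the leading principal minors of `g_i` and of the last
column of its adjugate. The second condition allows to scale the columns of `A i` to have last
coordinate `1`. The first one gives an `LU` decomposition of `g_i`, hence a unipotent upper
triangular matrix `b i` such that `b i * A i` is lower triangular and invertible
(`exists_isTriangularPosition`). For such matrices the initial ideal is computed directly:

* For a color-squarefree monomial with tuple `F ∉ T`, the product of the linear forms given by the
  rows `F i` of `b i`, over the colors that occur, has this monomial as its initial monomial. It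
  vanishes at the points of all `G ∈ T`, as otherwise `G ≤ F` and hence `F ∈ T`.
* A product of two variables of color `i` of `P(d, m)` agrees at the `m_i + 1` points of color `i`
  with a linear form times `x_{i, m_i + 1}`, and all monomials of the latter are smaller.
* The monomials outside `I(U)` are linearly independent modulo the ideal. In each multidegree this
  says that the `T × T` submatrix of the Kronecker product of the `A i` is nonsingular, which holds
  as this product is upper times lower triangular and `T` is an upper set
  (`eq_zero_of_sum_mul_prod_eq_zero`).

These facts determine the initial ideal by `initialIdeal_eq_span`. Uniqueness holds because nonempty
Zariski open subsets of the general linear group over an infinite field intersect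
(`IsZariskiOpen.inter_nonempty`).
-/

noncomputable section

namespace BalancedSqueezed

open MvPolynomial

/-! ### The reverse lexicographic order and initial ideals -/

section RevLex

variable {V : Type*} {prec : V → V → Prop}

theorem RevLexLT.irrefl (a : V →₀ ℕ) : ¬ RevLexLT prec a a := by
  rintro (h | ⟨-, v, h, -⟩)
  · exact lt_irrefl _ h
  · exact lt_irrefl _ h

theorem RevLexLT.trans [IsStrictTotalOrder V prec] {a b c : V →₀ ℕ}
    (hab : RevLexLT prec a b) (hbc : RevLexLT prec b c) : RevLexLT prec a c := by
  rcases hab with hab | ⟨hab, v, hv, hv'⟩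
  · rcases hbc with hbc | ⟨hbc, -⟩
    · exact Or.inl (hab.trans hbc)
    · exact Or.inl (hbc ▸ hab)
  · rcases hbc with hbc | ⟨hbc, w, hw, hw'⟩
    · exact Or.inl (hab ▸ hbc)
    · refine Or.inr ⟨hab.trans hbc, ?_⟩
      rcases trichotomous_of prec v w with h | rfl | h
      · exact ⟨v, hw' v h ▸ hv, fun x hx => (hv' x hx).trans (hw' x (_root_.trans hx h))⟩
      · exact ⟨v, hw.trans hv, fun x hx => (hv' x hx).trans (hw' x hx)⟩
      · exact ⟨w, hv' w h ▸ hw, fun x hx => (hv' x (_root_.trans hx h)).trans (hw' x hx)⟩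

theorem RevLexLT.add_right {a b : V →₀ ℕ} (h : RevLexLT prec a b) (c : V →₀ ℕ) :
    RevLexLT prec (a + c) (b + c) := by
  rcases h with h | ⟨h, v, hv, hv'⟩
  · left; simpa [map_add] using h
  · right
    refine ⟨by simp [map_add, h], v, by simpa using hv, fun w hw => by simp [hv' w hw]⟩

theorem RevLexLT.add_left {a b : V →₀ ℕ} (h : RevLexLT prec a b) (c : V →₀ ℕ) :
    RevLexLT prec (c + a) (c + b) := by
  rw [add_comm c, add_comm c]; exact h.add_right c

theorem RevLexLT.wellFounded [Finite V] [IsStrictTotalOrder V prec] :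
    WellFounded (RevLexLT prec) := by
  classical
  have hfin : ∀ a : V →₀ ℕ, {b | RevLexLT prec b a}.Finite := fun a => by
    refine (Set.finite_Iic (Finsupp.equivFunOnFinite.symm fun _ : V => a.degree)).subset ?_
    intro b hb v
    have h1 : b.degree ≤ a.degree := by
      rcases hb with hb | ⟨hb, -⟩
      exacts [hb.le, hb.le]
    exact (Finsupp.le_degree v b).trans h1
  refine Subrelation.wf (r := InvImage (· < ·) fun a => {b | RevLexLT prec b a}.ncard) ?_
    (InvImage.wf _ wellFounded_lt)
  intro a b hab
  refine Set.ncard_lt_ncard ⟨fun c hc => hc.trans hab, fun h => ?_⟩ (hfin b)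
  exact RevLexLT.irrefl a (h hab)

variable {K : Type*} [Field K]

/-- `f` is monic with initial monomial `x^a`: all monomials of `f - x^a` are smaller than `x^a`. -/
def IsMonicLead (prec : V → V → Prop) (f : MvPolynomial V K) (a : V →₀ ℕ) : Prop :=
  ∀ b ∈ (f - monomial a 1).support, RevLexLT prec b a

theorem IsMonicLead.isInitialExponent {f : MvPolynomial V K} {a : V →₀ ℕ}
    (h : IsMonicLead prec f a) : IsInitialExponent prec f a := by
  classical
  constructor
  · have h0 : (f - monomial a 1).coeff a = 0 := by
      by_contra h0
      exact RevLexLT.irrefl a (h a (mem_support_iff.2 h0))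
    rw [coeff_sub, coeff_monomial, if_pos rfl, sub_eq_zero] at h0
    rw [mem_support_iff, h0]
    exact one_ne_zero
  · intro b hb hba
    apply h
    rw [mem_support_iff] at hb ⊢
    rwa [coeff_sub, coeff_monomial, if_neg (Ne.symm hba), sub_zero]

theorem isMonicLead_one : IsMonicLead prec (1 : MvPolynomial V K) 0 := by
  intro b hb
  simp [← C_apply] at hb

theorem IsMonicLead.mul [IsStrictTotalOrder V prec] {f g : MvPolynomial V K} {a b : V →₀ ℕ}
    (hf : IsMonicLead prec f a) (hg : IsMonicLead prec g b) :
    IsMonicLead prec (f * g) (a + b) := by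
  classical
  intro c hc
  have h : f * g - monomial (a + b) 1 = monomial a 1 * (g - monomial b 1) +
      (f - monomial a 1) * monomial b 1 + (f - monomial a 1) * (g - monomial b 1) := by
    rw [show monomial (a + b) (1 : K) = monomial a 1 * monomial b 1 by simp [monomial_mul]]
    ring
  rw [h] at hc
  have hmon : ∀ a : V →₀ ℕ, ∀ x ∈ (monomial a (1 : K)).support, x = a := fun a x hx => by
    simpa using support_monomial_subset hx
  rcases Finset.mem_union.1 (support_add hc) with hc | hc
  · rcases Finset.mem_union.1 (support_add hc) with hc | hc
    · obtain ⟨x, hx, y, hy, rfl⟩ := Finset.mem_add.1 (support_mul _ _ hc)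
      rw [hmon a x hx]
      exact (hg y hy).add_left a
    · obtain ⟨x, hx, y, hy, rfl⟩ := Finset.mem_add.1 (support_mul _ _ hc)
      rw [hmon b y hy]
      exact (hf x hx).add_right b
  · obtain ⟨x, hx, y, hy, rfl⟩ := Finset.mem_add.1 (support_mul _ _ hc)
    exact ((hf x hx).add_right y).trans ((hg y hy).add_left a)

theorem isMonicLead_monomial (a : V →₀ ℕ) : IsMonicLead prec (monomial a (1 : K)) a := by
  intro b hb
  simp at hb

theorem IsMonicLead.prod [IsStrictTotalOrder V prec] {ι : Type*} (s : Finset ι)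
    {f : ι → MvPolynomial V K} {a : ι → V →₀ ℕ} (h : ∀ i ∈ s, IsMonicLead prec (f i) (a i)) :
    IsMonicLead prec (∏ i ∈ s, f i) (∑ i ∈ s, a i) := by
  classical
  induction s using Finset.induction_on with
  | empty => simpa using isMonicLead_one
  | insert i s hi ih =>
    rw [Finset.prod_insert hi, Finset.sum_insert hi]
    exact (h i (Finset.mem_insert_self i s)).mul
      (ih fun j hj => h j (Finset.mem_insert_of_mem hj))

/-- If every monomial of `p` has a remainder modulo `I`, then so has `p`. -/
theorem exists_remainder_of_support {I : Ideal (MvPolynomial V K)} {N : Set (V →₀ ℕ)}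
    (p : MvPolynomial V K)
    (h : ∀ b ∈ p.support, ∃ r, monomial b 1 - r ∈ I ∧
      ∀ c ∈ r.support, c ∉ N ∧ (c = b ∨ RevLexLT prec c b)) :
    ∃ r, p - r ∈ I ∧ ∀ c ∈ r.support, c ∉ N ∧ ∃ b ∈ p.support, c = b ∨ RevLexLT prec c b := by
  classical
  choose! r hr hr' using h
  refine ⟨∑ b ∈ p.support, C (p.coeff b) * r b, ?_, fun c hc => ?_⟩
  · have : p - ∑ b ∈ p.support, C (p.coeff b) * r b =
        ∑ b ∈ p.support, C (p.coeff b) * (monomial b 1 - r b) := by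
      conv_lhs => rw [p.as_sum]
      simp only [mul_sub, Finset.sum_sub_distrib, C_mul_monomial, mul_one]
      congr 1
      rw [← p.as_sum]
    rw [this]
    exact I.sum_mem fun b hb => I.mul_mem_left _ (hr b hb)
  · obtain ⟨b, hb, hc⟩ := Finset.mem_biUnion.1 (support_sum hc)
    rw [← smul_eq_C_mul] at hc
    have hc' := hr' b hb c (support_smul hc)
    exact ⟨hc'.1, b, hb, hc'.2⟩

theorem exists_remainder [Finite V] [IsStrictTotalOrder V prec]
    {I : Ideal (MvPolynomial V K)} {N : Set (V →₀ ℕ)}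
    (hlead : ∀ a ∈ N, ∃ f ∈ I, ∃ b ≤ a, IsMonicLead prec f b) (a : V →₀ ℕ) :
    ∃ r, monomial a 1 - r ∈ I ∧ ∀ c ∈ r.support, c ∉ N ∧ (c = a ∨ RevLexLT prec c a) := by
  induction a using (RevLexLT.wellFounded (prec := prec)).induction with
  | _ a ih =>
  by_cases ha : a ∈ N
  · obtain ⟨f, hf, b, hba, hfb⟩ := hlead a ha
    set g := monomial (a - b) 1 * f with hg
    have hgI : g ∈ I := I.mul_mem_left _ hf
    have hga : IsMonicLead prec g a := by
      have := (isMonicLead_monomial (prec := prec) (K := K) (a - b)).mul hfb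
      rwa [tsub_add_cancel_of_le hba] at this
    have hs : ∀ b ∈ (monomial a 1 - g).support, RevLexLT prec b a := fun b hb => by
      rw [← neg_sub, support_neg] at hb
      exact hga b hb
    obtain ⟨r, hr, hr'⟩ := exists_remainder_of_support (prec := prec) (I := I) (N := N)
      (monomial a 1 - g) fun b hb => ih b (hs b hb)
    refine ⟨r, ?_, fun c hc => ⟨(hr' c hc).1, Or.inr ?_⟩⟩
    · have := I.add_mem hr hgI
      rwa [show monomial a 1 - g - r + g = monomial a 1 - r by ring] at this
    · obtain ⟨b, hb, rfl | hcb⟩ := (hr' c hc).2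
      · exact hs _ hb
      · exact hcb.trans (hs b hb)
  · refine ⟨monomial a 1, by simp, fun c hc => ?_⟩
    obtain rfl : c = a := by simpa using support_monomial_subset hc
    exact ⟨ha, Or.inl rfl⟩

/-- A criterion for an initial ideal to be spanned by the monomials in `N`: each of them is
divisible by an initial monomial, and the remaining monomials are linearly independent modulo
`I`. -/
theorem initialIdeal_eq_span [Finite V] [IsStrictTotalOrder V prec]
    {I : Ideal (MvPolynomial V K)} {N : Set (V →₀ ℕ)}
    (hlead : ∀ a ∈ N, ∃ f ∈ I, ∃ b ≤ a, IsMonicLead prec f b)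
    (hindep : ∀ f ∈ I, (∀ a ∈ f.support, a ∉ N) → f = 0) :
    initialIdeal prec I = Ideal.span ((fun a => monomial a (1 : K)) '' N) := by
  classical
  apply le_antisymm
  · refine Ideal.span_le.2 ?_
    rintro _ ⟨f, hf, a, ha, rfl⟩
    by_cases haN : a ∈ N
    · exact Ideal.subset_span ⟨a, haN, rfl⟩
    exfalso
    -- Replacing the smaller monomials of `f` by their remainders keeps the initial monomial.
    obtain ⟨r, hr, hr'⟩ := exists_remainder_of_support (prec := prec) (I := I) (N := N)
      (f - monomial a (f.coeff a)) fun b _ => exists_remainder hlead b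
    have hlt : ∀ b ∈ (f - monomial a (f.coeff a)).support, RevLexLT prec b a := by
      intro b hb
      have hba : b ≠ a := by
        rintro rfl
        simp at hb
      refine ha.2 b ?_ hba
      rw [mem_support_iff] at hb ⊢
      rwa [coeff_sub, coeff_monomial, if_neg (Ne.symm hba), sub_zero] at hb
    have hra : r.coeff a = 0 := by
      by_contra h
      obtain ⟨b, hb, rfl | hab⟩ := (hr' a (mem_support_iff.2 h)).2
      · exact RevLexLT.irrefl _ (hlt _ hb)
      · exact RevLexLT.irrefl _ (hab.trans (hlt _ hb))
    have hmem : monomial a (f.coeff a) + r ∈ I := by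
      have := I.sub_mem hf hr
      rwa [show f - (f - monomial a (f.coeff a) - r) = monomial a (f.coeff a) + r by ring] at this
    have hzero := hindep _ hmem fun c hc => by
      rcases Finset.mem_union.1 (support_add hc) with hc | hc
      · obtain rfl : c = a := by simpa using support_monomial_subset hc
        exact haN
      · exact (hr' c hc).1
    have := congrArg (coeff a) hzero
    rw [coeff_add, coeff_monomial, if_pos rfl, hra, add_zero, coeff_zero] at this
    exact mem_support_iff.1 ha.1 this
  · refine Ideal.span_le.2 ?_
    rintro _ ⟨a, haN, rfl⟩
    obtain ⟨f, hf, b, hba, hfb⟩ := hlead a haN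
    have hb : monomial b (1 : K) ∈ initialIdeal prec I :=
      Ideal.subset_span ⟨f, hf, b, hfb.isInitialExponent, rfl⟩
    have := (initialIdeal prec I).mul_mem_left (monomial (a - b) 1) hb
    rwa [monomial_mul, tsub_add_cancel_of_le hba, one_mul] at this

end RevLex

/-! ### Color-squarefree monomials as tuples -/

section Tuples

variable {d : ℕ} {m : Fin d → ℕ}

/-- The color-squarefree monomial of `P(d, m)` encoded by a tuple `F`: it contains the variable
`x_{i, F i}` if `F i` is not the last position of color `i`, and no variable of color `i`
otherwise. -/
def tupleMonomial (F : ∀ i, Fin (m i + 1)) : Var m →₀ ℕ :=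
  Finsupp.equivFunOnFinite.symm fun v => if v.2.castSucc = F v.1 then 1 else 0

@[simp] theorem tupleMonomial_apply (F : ∀ i, Fin (m i + 1)) (v : Var m) :
    tupleMonomial F v = if v.2.castSucc = F v.1 then 1 else 0 := rfl

/-- The tuple that encodes a color-squarefree monomial, with the last position for the colors that
do not occur. -/
def monomialTuple (u : Var m →₀ ℕ) (i : Fin d) : Fin (m i + 1) :=
  open Classical in if h : ∃ j : Fin (m i), u ⟨i, j⟩ ≠ 0 then h.choose.castSucc else Fin.last _

theorem tupleMonomial_monomialTuple {u : Var m →₀ ℕ} (hu : IsColorSquarefree u) :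
    tupleMonomial (monomialTuple u) = u := by
  ext ⟨i, j⟩
  rw [tupleMonomial_apply, monomialTuple]
  dsimp only
  split_ifs with h1 h2 h2
  · have h3 := h1.choose_spec
    rw [← Fin.castSucc_injective _ h2] at h3
    have := hu.1 ⟨i, j⟩
    omega
  · by_contra h3
    have h4 := hu.2 ⟨i, j⟩ (Finsupp.mem_support_iff.2 (Ne.symm h3)) ⟨i, h1.choose⟩
      (Finsupp.mem_support_iff.2 h1.choose_spec) rfl
    simp only [Sigma.mk.injEq, heq_eq_eq, true_and] at h4
    exact h2 (congrArg Fin.castSucc h4)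
  · exact absurd h2 (Fin.castSucc_lt_last j).ne
  · by_contra h3
    exact h1 ⟨j, Ne.symm h3⟩

theorem tupleMonomial_update_castSucc (F : ∀ i, Fin (m i + 1)) (i : Fin d) (j : Fin (m i)) :
    tupleMonomial (Function.update F i j.castSucc) =
      tupleMonomial (Function.update F i (Fin.last (m i))) + Finsupp.single ⟨i, j⟩ 1 := by
  ext ⟨k, l⟩
  rw [Finsupp.add_apply, tupleMonomial_apply, tupleMonomial_apply]
  rcases eq_or_ne k i with rfl | hk
  · have hl : ¬ l.castSucc = Fin.last (m k) := (Fin.castSucc_lt_last l).ne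
    simp [hl, Finsupp.single_apply, eq_comm]
  · have hne : (⟨i, j⟩ : Var m) ≠ ⟨k, l⟩ := fun h => hk (congrArg Sigma.fst h).symm
    simp [hk]

variable {U : Set (Var m →₀ ℕ)}

theorem tupleMonomial_update_mem (hU : IsColorSquarefreeShifted U) {F : ∀ i, Fin (m i + 1)}
    (hF : tupleMonomial F ∈ U) {i : Fin d} {k : Fin (m i + 1)} (hk : F i ≤ k) :
    tupleMonomial (Function.update F i k) ∈ U := by
  rw [← Function.update_eq_self i F] at hF
  generalize F i = l at hF hk
  induction l using Fin.lastCases with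
  | last => rwa [Fin.last_le_iff.1 hk]
  | cast l =>
    rw [tupleMonomial_update_castSucc] at hF
    induction k using Fin.lastCases with
    | last => exact hU.closed_under_divisors _ hF _ le_self_add
    | cast k =>
      rw [tupleMonomial_update_castSucc]
      exact hU.shifted _ _ _ _ (Fin.castSucc_le_castSucc_iff.1 hk) hF

/-- The tuples of the monomials in a color-squarefree shifted order ideal form an upper set. -/
theorem tupleMonomial_mem_of_le (hU : IsColorSquarefreeShifted U) {F G : ∀ i, Fin (m i + 1)}
    (hF : tupleMonomial F ∈ U) (hFG : F ≤ G) : tupleMonomial G ∈ U := by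
  have key : ∀ s : Finset (Fin d), tupleMonomial (s.piecewise G F) ∈ U := fun s => by
    induction s using Finset.induction_on with
    | empty => simpa using hF
    | insert i s hi ih =>
      rw [Finset.piecewise_insert]
      refine tupleMonomial_update_mem hU ih ?_
      rw [Finset.piecewise_eq_of_notMem _ _ _ hi]
      exact hFG i
  simpa using key Finset.univ

/-- The part of a monomial of `P(d, m + 1)` in the variables of `P(d, m)`. -/
def dropLast (a : Var (addOne m) →₀ ℕ) : Var m →₀ ℕ :=
  Finsupp.equivFunOnFinite.symm fun v => a (embVar v)

@[simp] theorem dropLast_apply (a : Var (addOne m) →₀ ℕ) (v : Var m) :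
    dropLast a v = a (embVar v) := rfl

theorem embVar_injective : Function.Injective (embVar : Var m → Var (addOne m)) := by
  rintro ⟨i, j⟩ ⟨k, l⟩ h
  simp only [embVar, Sigma.mk.injEq] at h
  obtain ⟨rfl, h⟩ := h
  rw [Fin.castSucc_injective _ (eq_of_heq h)]

theorem mapDomain_embVar_le_iff (u : Var m →₀ ℕ) (a : Var (addOne m) →₀ ℕ) :
    u.mapDomain embVar ≤ a ↔ u ≤ dropLast a := by
  constructor
  · intro h v
    have := h (embVar v)
    rwa [Finsupp.mapDomain_apply embVar_injective] at this
  · intro h v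
    by_cases hv : v ∈ Set.range (embVar : Var m → Var (addOne m))
    · obtain ⟨w, rfl⟩ := hv
      rw [Finsupp.mapDomain_apply embVar_injective]
      exact h w
    · rw [Finsupp.mapDomain_of_notMem_range _ _ hv]
      exact Nat.zero_le _

/-- The multidegree of a monomial of `P(d, m + 1)`. -/
def multidegree {n : Fin d → ℕ} (a : Var n →₀ ℕ) : Fin d →₀ ℕ := a.mapDomain Sigma.fst

theorem multidegree_apply {n : Fin d → ℕ} (a : Var n →₀ ℕ) (i : Fin d) :
    multidegree a i = ∑ j, a ⟨i, j⟩ := by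
  classical
  rw [multidegree, Finsupp.mapDomain, Finsupp.sum_fintype _ _ (by simp), Fintype.sum_sigma,
    Finsupp.finsetSum_apply, Finset.sum_eq_single i]
  · simp [Finsupp.finsetSum_apply]
  · intro k _ hk
    simp [Finsupp.finsetSum_apply, hk]
  · simp

theorem ext_of_dropLast_of_multidegree {a b : Var (addOne m) →₀ ℕ}
    (h : dropLast a = dropLast b) (h' : multidegree a = multidegree b) : a = b := by
  have h1 : ∀ i (j : Fin (m i)), a ⟨i, j.castSucc⟩ = b ⟨i, j.castSucc⟩ := fun i j =>
    DFunLike.congr_fun h (⟨i, j⟩ : Var m)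
  ext ⟨i, j⟩
  induction j using Fin.lastCases with
  | cast j => exact h1 i j
  | last =>
    have h2 := DFunLike.congr_fun h' i
    rw [multidegree_apply, multidegree_apply, Fin.sum_univ_castSucc, Fin.sum_univ_castSucc,
      Finset.sum_congr rfl fun j _ => h1 i j] at h2
    exact Nat.add_left_cancel h2

/-- A set of vertices is a face exactly if it is part of the graph of the tuple of some monomial
in `U`. -/
theorem mem_balancedComplex_iff (hU : IsColorSquarefreeShifted U)
    (s : Finset (Var (addOne m))) :
    s ∈ balancedComplex U ↔
      ∃ F : ∀ i, Fin (m i + 1), tupleMonomial F ∈ U ∧ ∀ v ∈ s, v.2 = F v.1 := by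
  have hfacet : ∀ (F : ∀ i, Fin (m i + 1)) (v : Var (addOne m)),
      v ∈ facet (tupleMonomial F) ↔ v.2 = F v.1 := by
    rintro F ⟨i, j⟩
    simp only [facet, Finset.mem_union, Finset.mem_image, Finsupp.mem_support_iff,
      Finset.mem_filter, Finset.mem_univ, true_and]
    simp only [tupleMonomial_apply]
    constructor
    · rintro (⟨⟨k, l⟩, hl, h⟩ | ⟨k, hk, h⟩)
      · simp only [embVar, Sigma.mk.injEq] at h
        obtain ⟨rfl, h⟩ := h
        obtain rfl := eq_of_heq h
        by_contra hne
        exact hl (if_neg hne)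
      · simp only [lastVar, Sigma.mk.injEq] at h
        obtain ⟨rfl, h⟩ := h
        obtain rfl := eq_of_heq h
        by_contra hne
        obtain ⟨f, hf⟩ := Fin.exists_castSucc_eq.2 (Ne.symm hne)
        exact absurd (hk f) (by simp [hf])
    · intro h
      induction j using Fin.lastCases with
      | last =>
        refine Or.inr ⟨i, fun k => if_neg ?_, rfl⟩
        rw [← h]
        exact (Fin.castSucc_lt_last k).ne
      | cast j => exact Or.inl ⟨⟨i, j⟩, by simp [h], rfl⟩
  rw [balancedComplex, mem_lowerClosure]
  constructor
  · rintro ⟨_, ⟨u, hu, rfl⟩, hs⟩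
    have hmon := tupleMonomial_monomialTuple (hU.colorSquarefree u hu)
    rw [← hmon] at hu hs
    exact ⟨_, hu, fun v hv => (hfacet _ v).1 (hs hv)⟩
  · rintro ⟨F, hF, hs⟩
    exact ⟨_, ⟨_, hF, rfl⟩, fun v hv => (hfacet F v).2 (hs v hv)⟩

end Tuples

/-! ### Monomial descriptions of the two ideals -/

section Ideals

variable {K : Type*} [Field K] {d : ℕ} {m : Fin d → ℕ} {U : Set (Var m →₀ ℕ)}

theorem extend_orderIdealIdeal_eq (hU : IsColorSquarefreeShifted U) :
    extend (orderIdealIdeal K U) =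
      Ideal.span ((fun a => monomial a (1 : K)) '' {a | dropLast a ∉ U}) := by
  rw [extend, orderIdealIdeal, Ideal.map_span]
  apply le_antisymm
  · refine Ideal.span_le.2 ?_
    rintro _ ⟨_, ⟨u, hu, rfl⟩, rfl⟩
    refine Ideal.subset_span ⟨u.mapDomain embVar, fun h => hu ?_, by simp [rename_monomial]⟩
    exact hU.closed_under_divisors _ h _ ((mapDomain_embVar_le_iff _ _).1 le_rfl)
  · refine Ideal.span_le.2 ?_
    rintro _ ⟨a, ha, rfl⟩
    have hle := (mapDomain_embVar_le_iff (dropLast a) a).2 le_rfl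
    have := Ideal.mul_mem_left _ (monomial (a - (dropLast a).mapDomain embVar) (1 : K))
      (Ideal.subset_span (s := (rename embVar : MvPolynomial (Var m) K →ₐ[K] _) ''
        ((fun u => monomial u (1 : K)) '' Uᶜ)) ⟨_, ⟨dropLast a, ha, rfl⟩, rfl⟩)
    simp only [rename_monomial, monomial_mul, tsub_add_cancel_of_le hle, one_mul] at this
    exact this

theorem monomial_mem_extend_iff (hU : IsColorSquarefreeShifted U) (a : Var (addOne m) →₀ ℕ) :
    monomial a (1 : K) ∈ extend (orderIdealIdeal K U) ↔ dropLast a ∉ U := by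
  classical
  rw [extend_orderIdealIdeal_eq hU, mem_ideal_span_monomial_image]
  constructor
  · intro h
    obtain ⟨b, hb, hba⟩ := h a (by simp [support_monomial])
    exact fun ha => hb (hU.closed_under_divisors _ ha _ fun v => hba (embVar v))
  · intro h b hb
    obtain rfl : b = a := by simpa using support_monomial_subset hb
    exact ⟨b, h, le_rfl⟩

theorem isStronglyColorStable_extend (hU : IsColorSquarefreeShifted U) :
    IsStronglyColorStable (extend (orderIdealIdeal K U)) := by
  refine ⟨⟨_, extend_orderIdealIdeal_eq hU⟩, fun u k j l hjl h => ?_⟩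
  rw [monomial_mem_extend_iff hU] at h ⊢
  contrapose! h
  have hcast : ∀ j : Fin (m k), dropLast (u + Finsupp.single ⟨k, j.castSucc⟩ 1) =
      dropLast u + Finsupp.single ⟨k, j⟩ 1 := fun j => by
    ext v
    simp only [dropLast_apply, Finsupp.add_apply, Finsupp.single_apply]
    congr 1
    refine if_congr ?_ rfl rfl
    exact (embVar_injective (m := m)).eq_iff (a := ⟨k, j⟩) (b := v)
  obtain ⟨j, rfl⟩ := Fin.exists_castSucc_eq.2 (hjl.trans_le (Fin.le_last l)).ne
  rw [hcast] at h
  induction l using Fin.lastCases with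
  | cast l =>
    rw [hcast]
    exact hU.shifted _ _ _ _ (Fin.castSucc_lt_castSucc_iff.1 hjl).le h
  | last =>
    refine hU.closed_under_divisors _ h _ fun v => ?_
    have : (⟨k, Fin.last (m k)⟩ : Var (addOne m)) ≠ embVar v := fun hv => by
      obtain ⟨i, l⟩ := v
      simp only [embVar, Sigma.mk.injEq] at hv
      obtain ⟨rfl, hv⟩ := hv
      exact (Fin.castSucc_lt_last l).ne (eq_of_heq hv).symm
    simp [Finsupp.single_apply, this]

theorem mem_stanleyReisnerIdeal_iff {V : Type*} (Δ : LowerSet (Finset V))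
    (f : MvPolynomial V K) :
    f ∈ stanleyReisnerIdeal K Δ ↔ ∀ a ∈ f.support, a.support ∉ Δ := by
  classical
  have h : {f : MvPolynomial V K | ∃ F : Finset V, F ∉ Δ ∧ f = ∏ v ∈ F, X v} =
      (fun a => monomial a (1 : K)) ''
        {a | ∃ F : Finset V, F ∉ Δ ∧ a = ∑ v ∈ F, Finsupp.single v 1} := by
    ext f
    simp only [Set.mem_image, Set.mem_ofPred_eq]
    constructor
    · rintro ⟨F, hF, rfl⟩
      exact ⟨_, ⟨F, hF, rfl⟩, by rw [monomial_sum_index]; simp [X]⟩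
    · rintro ⟨_, ⟨F, hF, rfl⟩, rfl⟩
      exact ⟨F, hF, by rw [monomial_sum_index]; simp [X]⟩
  have hind : ∀ (F : Finset V) (v : V),
      (∑ w ∈ F, Finsupp.single w 1 : V →₀ ℕ) v = if v ∈ F then 1 else 0 := fun F v => by
    simp [Finsupp.finsetSum_apply, Finsupp.single_apply]
  rw [stanleyReisnerIdeal, h, mem_ideal_span_monomial_image]
  refine forall₂_congr fun a _ => ⟨?_, fun ha => ⟨_, ⟨a.support, ha, rfl⟩, fun v => ?_⟩⟩
  · rintro ⟨_, ⟨F, hF, rfl⟩, hle⟩ ha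
    refine hF (Δ.lower (fun v hv => ?_) ha)
    have := hle v
    rw [hind, if_pos hv] at this
    exact Finsupp.mem_support_iff.2 (by omega)
  · rw [hind]
    split_ifs with hv
    · exact Nat.one_le_iff_ne_zero.2 (Finsupp.mem_support_iff.1 hv)
    · exact Nat.zero_le _

end Ideals

/-! ### Evaluation of polynomials at the facets -/

section Evaluation

variable {K : Type*} [Field K] {d : ℕ} {m : Fin d → ℕ} {U : Set (Var m →₀ ℕ)}

/-- The substitution `x_{i,j} ↦ A_i(j, F i) t_i` into the polynomial ring with one variable `t_i`
for each color. Keeping the `t_i` amounts to evaluating each multigraded component at the point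
whose coordinates of color `i` form the column `F i` of the matrix `A_i`. -/
def evalTuple (A : ∀ i, Matrix (Fin (m i + 1)) (Fin (m i + 1)) K) (F : ∀ i, Fin (m i + 1)) :
    MvPolynomial (Var (addOne m)) K →ₐ[K] MvPolynomial (Fin d) K :=
  aeval fun v => C (A v.1 v.2 (F v.1)) * X v.1

theorem evalTuple_X (A : ∀ i, Matrix (Fin (m i + 1)) (Fin (m i + 1)) K)
    (F : ∀ i, Fin (m i + 1)) (v : Var (addOne m)) :
    evalTuple A F (X v) = C (A v.1 v.2 (F v.1)) * X v.1 := by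
  simp [evalTuple]

theorem evalTuple_monomial (A : ∀ i, Matrix (Fin (m i + 1)) (Fin (m i + 1)) K)
    (F : ∀ i, Fin (m i + 1)) (a : Var (addOne m) →₀ ℕ) (r : K) :
    evalTuple A F (monomial a r) =
      monomial (multidegree a) (r * ∏ v : Var (addOne m), A v.1 v.2 (F v.1) ^ a v) := by
  rw [evalTuple, aeval_monomial, Finsupp.prod_fintype _ _ (by simp), multidegree,
    Finsupp.mapDomain, Finsupp.sum_fintype _ _ (by simp), monomial_sum_index]
  simp only [mul_pow, Finset.prod_mul_distrib, map_mul, map_prod, map_pow, algebraMap_eq, mul_assoc]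
  congr 2
  refine Finset.prod_congr rfl fun v _ => ?_
  rw [X_pow_eq_monomial]

theorem coeff_evalTuple (A : ∀ i, Matrix (Fin (m i + 1)) (Fin (m i + 1)) K)
    (F : ∀ i, Fin (m i + 1)) (f : MvPolynomial (Var (addOne m)) K) (c : Fin d →₀ ℕ) :
    (evalTuple A F f).coeff c = ∑ a ∈ f.support with multidegree a = c,
      f.coeff a * ∏ v : Var (addOne m), A v.1 v.2 (F v.1) ^ a v := by
  classical
  conv_lhs => rw [f.as_sum]
  rw [map_sum, coeff_sum, Finset.sum_filter]
  refine Finset.sum_congr rfl fun a _ => ?_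
  rw [evalTuple_monomial, coeff_monomial]

/-- The Stanley-Reisner ideal consists of the polynomials that vanish on the coordinate subspaces
spanned by the facets; the coordinates may be rescaled by nonzero factors. -/
theorem mem_stanleyReisnerIdeal_balancedComplex_iff (hU : IsColorSquarefreeShifted U)
    {c : ∀ i, Fin (m i + 1) → K} (hc : ∀ i j, c i j ≠ 0) (f : MvPolynomial (Var (addOne m)) K) :
    f ∈ stanleyReisnerIdeal K (balancedComplex U) ↔
      ∀ F : ∀ i, Fin (m i + 1), tupleMonomial F ∈ U →
        evalTuple (fun i => Matrix.diagonal (c i)) F f = 0 := by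
  classical
  have hprod : ∀ (F : ∀ i, Fin (m i + 1)) (a : Var (addOne m) →₀ ℕ),
      ∏ v : Var (addOne m), Matrix.diagonal (c v.1) v.2 (F v.1) ^ a v ≠ 0 ↔
        ∀ v ∈ a.support, v.2 = F v.1 := fun F a => by
    rw [Finset.prod_ne_zero_iff]
    refine forall_congr' fun v => ?_
    by_cases hv : v.2 = F v.1
    · have := hc v.1 (F v.1)
      simp [hv, this]
    · simp [hv]
  rw [mem_stanleyReisnerIdeal_iff]
  constructor
  · intro h F hF
    ext k
    rw [coeff_evalTuple, coeff_zero]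
    refine Finset.sum_eq_zero fun a ha => ?_
    have ha' := h a (Finset.mem_filter.1 ha).1
    rw [mem_balancedComplex_iff hU] at ha'
    rw [not_not.1 fun h0 => ha' ⟨F, hF, (hprod F a).1 h0⟩, mul_zero]
  · intro h a ha ha'
    obtain ⟨F, hF, haF⟩ := (mem_balancedComplex_iff hU _).1 ha'
    have h0 := congrArg (coeff (multidegree a)) (h F hF)
    -- A monomial supported on the facet of `F` is determined by its multidegree.
    rw [coeff_evalTuple, coeff_zero, Finset.sum_eq_single a] at h0
    · exact mul_ne_zero (mem_support_iff.1 ha) ((hprod F a).2 haF) h0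
    · intro b hb hba
      rw [Finset.mem_filter] at hb
      by_contra hne
      have hbF := (hprod F b).1 (right_ne_zero_of_mul hne)
      have hdeg : ∀ e : Var (addOne m) →₀ ℕ, (∀ v ∈ e.support, v.2 = F v.1) →
          ∀ v : Var (addOne m), e v = if v.2 = F v.1 then multidegree e v.1 else 0 := by
        rintro e he ⟨i, j⟩
        have h1 : ∀ j, j ≠ F i → e ⟨i, j⟩ = 0 := fun j hj => by
          by_contra h2
          exact hj (he ⟨i, j⟩ (Finsupp.mem_support_iff.2 h2))
        split_ifs with h3
        · rw [multidegree_apply, Finset.sum_eq_single (F i) (fun j _ hj => h1 j hj) (by simp)]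
          exact congrArg (fun k => e ⟨i, k⟩) h3
        · exact h1 j h3
      refine hba (Finsupp.ext fun v => ?_)
      rw [hdeg b hbF, hdeg a haF, hb.2]
    · simp [ha]

theorem evalTuple_colorAction (g : ∀ i, GL (Fin (m i + 1)) K)
    (A : ∀ i, Matrix (Fin (m i + 1)) (Fin (m i + 1)) K) (F : ∀ i, Fin (m i + 1))
    (f : MvPolynomial (Var (addOne m)) K) :
    evalTuple A F (colorAction g f) =
      evalTuple (fun i => (g i : Matrix (Fin (m i + 1)) (Fin (m i + 1)) K).transpose * A i) F f := by
  have : (evalTuple A F).comp (colorAction g) =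
      evalTuple (fun i => (g i : Matrix (Fin (m i + 1)) (Fin (m i + 1)) K).transpose * A i) F := by
    refine algHom_ext fun v => ?_
    rw [AlgHom.comp_apply, evalTuple_X, colorAction, aeval_X, map_sum, Matrix.mul_apply, map_sum,
      Finset.sum_mul]
    refine Finset.sum_congr rfl fun k _ => ?_
    rw [map_mul, evalTuple_X, algHom_C, algebraMap_eq, Matrix.transpose_apply, map_mul, mul_assoc]
  exact DFunLike.congr_fun this f

theorem colorAction_comp_colorAction {n : Fin d → ℕ} (g h : ∀ i, GL (Fin (n i)) K)
    (f : MvPolynomial (Var n) K) :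
    colorAction g (colorAction h f) = colorAction (g * h) f := by
  have : (colorAction g).comp (colorAction h) = colorAction (g * h) := by
    refine algHom_ext fun v => ?_
    simp only [AlgHom.comp_apply, colorAction, aeval_X, map_sum, map_mul, algHom_C, algebraMap_eq,
      Pi.mul_apply, Units.val_mul, Matrix.mul_apply, Finset.sum_mul, Finset.mul_sum]
    rw [Finset.sum_comm]
    refine Finset.sum_congr rfl fun k _ => Finset.sum_congr rfl fun l _ => ?_
    ring
  exact DFunLike.congr_fun this f

theorem colorAction_one {n : Fin d → ℕ} (f : MvPolynomial (Var n) K) :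
    colorAction (1 : ∀ i, GL (Fin (n i)) K) f = f := by
  have : colorAction (1 : ∀ i, GL (Fin (n i)) K) = AlgHom.id K _ := by
    refine algHom_ext fun v => ?_
    rw [colorAction, aeval_X, AlgHom.id_apply, Finset.sum_eq_single v.2]
    · simp
    · intro k _ hk
      simp [Matrix.one_apply_ne hk]
    · simp
  rw [this, AlgHom.id_apply]

theorem mem_map_colorAction_iff {n : Fin d → ℕ} (g : ∀ i, GL (Fin (n i)) K)
    (I : Ideal (MvPolynomial (Var n) K)) (f : MvPolynomial (Var n) K) :
    f ∈ I.map (colorAction g) ↔ colorAction g⁻¹ f ∈ I := by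
  constructor
  · intro h
    have hle : I.map (colorAction g) ≤ I.comap (colorAction g⁻¹) := by
      rw [Ideal.map_le_iff_le_comap]
      intro f hf
      rw [Ideal.mem_comap, Ideal.mem_comap, colorAction_comp_colorAction, inv_mul_cancel,
        colorAction_one]
      exact hf
    exact hle h
  · intro h
    have := Ideal.mem_map_of_mem (colorAction g) h
    rwa [colorAction_comp_colorAction, mul_inv_cancel, colorAction_one] at this

/-- After a coordinate change, the Stanley-Reisner ideal consists of the polynomials that vanish
at the points given by the columns of the matrices `(g_i⁻¹)ᵀ`, up to scaling. -/
theorem mem_map_colorAction_stanleyReisnerIdeal_iff (hU : IsColorSquarefreeShifted U)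
    {c : ∀ i, Fin (m i + 1) → K} (hc : ∀ i j, c i j ≠ 0) (g : ∀ i, GL (Fin (m i + 1)) K)
    (f : MvPolynomial (Var (addOne m)) K) :
    f ∈ (stanleyReisnerIdeal K (balancedComplex U)).map (colorAction g) ↔
      ∀ F : ∀ i, Fin (m i + 1), tupleMonomial F ∈ U →
        evalTuple (fun i => (g i : Matrix (Fin (m i + 1)) (Fin (m i + 1)) K)⁻¹.transpose *
          Matrix.diagonal (c i)) F f = 0 := by
  rw [mem_map_colorAction_iff, mem_stanleyReisnerIdeal_balancedComplex_iff hU hc]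
  refine forall₂_congr fun F _ => ?_
  rw [evalTuple_colorAction]
  simp only [Pi.inv_apply, Matrix.coe_units_inv]

end Evaluation

/-! ### Points in triangular position -/

section Triangular

variable {K : Type*} [Field K]

/-- The columns of `A` are points with last coordinate `1` in triangular position: the rows of the
unipotent upper triangular matrix `b` are linear forms such that the `v`-th form vanishes at the
points after the `v`-th, but not at the `v`-th point. -/
structure IsTriangularPosition {n : ℕ} (A b : Matrix (Fin (n + 1)) (Fin (n + 1)) K) : Prop where
  apply_of_lt : ∀ v w, w < v → b v w = 0
  apply_self : ∀ v, b v v = 1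
  mul_apply_of_lt : ∀ v k, v < k → (b * A) v k = 0
  mul_apply_self_ne_zero : ∀ v, (b * A) v v ≠ 0
  apply_last : ∀ k, A (Fin.last n) k = 1

theorem IsTriangularPosition.det_eq_one {n : ℕ} {A b : Matrix (Fin (n + 1)) (Fin (n + 1)) K}
    (h : IsTriangularPosition A b) : b.det = 1 := by
  rw [Matrix.det_of_isUpperTriangular fun v w hvw => h.apply_of_lt v w hvw]
  simp [h.apply_self]

theorem IsTriangularPosition.isUnit_det {n : ℕ} {A b : Matrix (Fin (n + 1)) (Fin (n + 1)) K}
    (h : IsTriangularPosition A b) : IsUnit A.det := by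
  have h1 : (b * A).det = A.det := by rw [Matrix.det_mul, h.det_eq_one, one_mul]
  rw [← h1, Matrix.det_of_isLowerTriangular _ fun v w hvw => h.mul_apply_of_lt v w hvw,
    isUnit_iff_ne_zero]
  exact Finset.prod_ne_zero_iff.2 fun v _ => h.mul_apply_self_ne_zero v

theorem prod_mul_apply {d : ℕ} {n : Fin d → ℕ}
    (A B : ∀ i, Matrix (Fin (n i)) (Fin (n i)) K) (u w : ∀ i, Fin (n i)) :
    ∏ i, (A i * B i) (u i) (w i) =
      ∑ x : ∀ i, Fin (n i), (∏ i, A i (u i) (x i)) * ∏ i, B i (x i) (w i) := by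
  simp only [Matrix.mul_apply]
  rw [Fintype.prod_sum]
  simp only [Finset.prod_mul_distrib]

/-- The submatrix of the Kronecker product of the `A i` that belongs to an upper set of tuples has
linearly independent rows. -/
theorem eq_zero_of_sum_mul_prod_eq_zero {d : ℕ} {n : Fin d → ℕ}
    {A b : ∀ i, Matrix (Fin (n i + 1)) (Fin (n i + 1)) K}
    (h : ∀ i, IsTriangularPosition (A i) (b i)) {T : Set (∀ i, Fin (n i + 1))} (hT : IsUpperSet T)
    {c : (∀ i, Fin (n i + 1)) → K} (hc : ∀ u ∉ T, c u = 0)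
    (hsum : ∀ F ∈ T, ∑ u, c u * ∏ i, A i (u i) (F i) = 0) (u : ∀ i, Fin (n i + 1)) : c u = 0 := by
  classical
  have hunit : ∀ i, IsUnit (b i).det := fun i => by rw [(h i).det_eq_one]; exact isUnit_one
  have hinv : ∀ i v w, w < v → (b i)⁻¹ v w = 0 := fun i v w hvw => by
    let := (b i).invertibleOfIsUnitDet (hunit i)
    exact Matrix.blockTriangular_inv_of_blockTriangular (b := id)
      (fun v w hvw => (h i).apply_of_lt v w hvw) hvw
  -- The coordinates of the given combination in the basis of the products of the rows of `b i`.
  set c' : (∀ i, Fin (n i + 1)) → K := fun w => ∑ u, c u * ∏ i, (b i)⁻¹ (u i) (w i) with hc'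
  have hc'T : ∀ w ∉ T, c' w = 0 := fun w hw => Finset.sum_eq_zero fun u _ => by
    by_cases hu : u ∈ T
    · have : ¬ u ≤ w := fun huw => hw (hT huw hu)
      obtain ⟨i, hi⟩ := not_forall.1 this
      rw [Finset.prod_eq_zero (Finset.mem_univ i) (hinv i _ _ (not_le.1 hi)), mul_zero]
    · rw [hc u hu, zero_mul]
  have hsum' : ∀ F ∈ T, ∑ w, c' w * ∏ i, (b i * A i) (w i) (F i) = 0 := fun F hF => by
    rw [← hsum F hF]
    simp only [hc', Finset.sum_mul]
    rw [Finset.sum_comm]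
    refine Finset.sum_congr rfl fun u _ => ?_
    simp only [mul_assoc]
    rw [← Finset.mul_sum, ← prod_mul_apply]
    simp only [Matrix.nonsing_inv_mul_cancel_left _ _ (hunit _)]
  have hzero : ∀ w, c' w = 0 := by
    by_contra! hne
    obtain ⟨w, hw⟩ := Set.Finite.exists_maximal (Set.toFinite {w | c' w ≠ 0}) hne
    have hwT : w ∈ T := by
      by_contra hwT
      exact hw.1 (hc'T w hwT)
    have h0 := hsum' w hwT
    rw [Finset.sum_eq_single w] at h0
    · exact mul_ne_zero hw.1
        (Finset.prod_ne_zero_iff.2 fun i _ => (h i).mul_apply_self_ne_zero _) h0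
    · intro x _ hxw
      by_cases hx : c' x = 0
      · rw [hx, zero_mul]
      · have : ¬ w ≤ x := fun hwx => hxw (le_antisymm (hw.2 hx hwx) hwx)
        obtain ⟨i, hi⟩ := not_forall.1 this
        rw [Finset.prod_eq_zero (Finset.mem_univ i) ((h i).mul_apply_of_lt _ _ (not_le.1 hi)),
          mul_zero]
    · simp
  have hcu : c u = ∑ w, c' w * ∏ i, b i (w i) (u i) := by
    simp only [hc', Finset.sum_mul]
    rw [Finset.sum_comm]
    simp only [mul_assoc]
    simp only [← Finset.mul_sum, ← prod_mul_apply, Matrix.nonsing_inv_mul _ (hunit _)]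
    rw [Finset.sum_eq_single u]
    · simp
    · intro x _ hxu
      obtain ⟨i, hi⟩ := Function.ne_iff.1 hxu
      refine mul_eq_zero_of_right _ (Finset.prod_eq_zero (Finset.mem_univ i) ?_)
      exact Matrix.one_apply_ne hi
    · simp
  rw [hcu]
  exact Finset.sum_eq_zero fun w _ => by rw [hzero w, zero_mul]

end Triangular

/-! ### The initial ideal for points in triangular position -/

section InitialIdeal

variable {K : Type*} [Field K] {d : ℕ} {m : Fin d → ℕ} {U : Set (Var m →₀ ℕ)}
  {prec : Var (addOne m) → Var (addOne m) → Prop}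
  {A b : ∀ i, Matrix (Fin (m i + 1)) (Fin (m i + 1)) K}

theorem isMonicLead_linearForm [IsStrictTotalOrder (Var (addOne m)) prec]
    (hprec : ∀ (i : Fin d) (j k : Fin (m i + 1)), j < k → prec ⟨i, k⟩ ⟨i, j⟩)
    (h : ∀ i, IsTriangularPosition (A i) (b i)) (i : Fin d) (v : Fin (m i + 1)) :
    IsMonicLead prec (∑ w, C (b i v w) * X (⟨i, w⟩ : Var (addOne m)))
      (Finsupp.single ⟨i, v⟩ 1) := by
  classical
  intro a ha
  rw [Fintype.sum_eq_add_sum_compl v, (h i).apply_self, C_1, one_mul, ← X, add_sub_cancel_left]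
    at ha
  obtain ⟨w, hw, haw⟩ := Finset.mem_biUnion.1 (support_sum ha)
  rw [C_mul_X_eq_monomial] at haw
  have hbw : b i v w ≠ 0 := by
    rintro h0
    simp [h0] at haw
  obtain rfl : a = Finsupp.single ⟨i, w⟩ 1 := by simpa using support_monomial_subset haw
  have hwv : w ≠ v := by simpa using hw
  have hvw : v < w := lt_of_le_of_ne (not_lt.1 fun hlt => hbw ((h i).apply_of_lt v w hlt)) hwv.symm
  refine Or.inr ⟨by simp, ⟨i, w⟩, ?_, fun x hx => ?_⟩
  · have : (⟨i, v⟩ : Var (addOne m)) ≠ ⟨i, w⟩ := by simpa using hvw.ne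
    simp [this]
  · have h1 : (⟨i, w⟩ : Var (addOne m)) ≠ x := fun h => irrefl_of prec _ (h ▸ hx)
    have h2 : (⟨i, v⟩ : Var (addOne m)) ≠ x := fun h =>
      irrefl_of prec _ (_root_.trans (h ▸ hx) (hprec i v w hvw))
    simp [h1, h2]

theorem isMonicLead_quadric [IsStrictTotalOrder (Var (addOne m)) prec]
    (hprec : ∀ (i : Fin d) (j k : Fin (m i + 1)), j < k → prec ⟨i, k⟩ ⟨i, j⟩)
    (i : Fin d) (j k : Fin (m i)) (r : Fin (m i + 1) → K) :
    IsMonicLead prec (X (embVar ⟨i, j⟩) * X (embVar ⟨i, k⟩) -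
        ∑ w, C (r w) * (X (⟨i, w⟩ : Var (addOne m)) * X (lastVar m i)))
      (Finsupp.single (embVar ⟨i, j⟩) 1 + Finsupp.single (embVar ⟨i, k⟩) 1) := by
  classical
  intro a ha
  have hXX : ∀ v w : Var (addOne m), (X v * X w : MvPolynomial (Var (addOne m)) K) =
      monomial (Finsupp.single v 1 + Finsupp.single w 1) 1 := fun v w => by
    rw [X, X, monomial_mul, one_mul]
  rw [← hXX, sub_sub_cancel_left, support_neg] at ha
  obtain ⟨w, -, haw⟩ := Finset.mem_biUnion.1 (support_sum ha)
  rw [hXX, C_mul_monomial] at haw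
  obtain rfl : a = Finsupp.single ⟨i, w⟩ 1 + Finsupp.single (lastVar m i) 1 := by
    simpa using support_monomial_subset haw
  have hlast : ∀ l : Fin (m i), prec (lastVar m i) (embVar ⟨i, l⟩) := fun l =>
    hprec i _ _ (Fin.castSucc_lt_last l)
  have hlast' : ∀ x, prec x (lastVar m i) → ∀ w, (⟨i, w⟩ : Var (addOne m)) ≠ x := by
    rintro x hx w rfl
    rcases (Fin.le_last w).lt_or_eq with hw | rfl
    · exact irrefl_of prec _ (_root_.trans hx (hprec i _ _ hw))
    · exact irrefl_of prec _ hx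
  refine Or.inr ⟨by simp, lastVar m i, ?_, fun x hx => ?_⟩
  · have hne : ∀ l : Fin (m i), embVar ⟨i, l⟩ ≠ lastVar m i := fun l h =>
      irrefl_of prec _ (h ▸ hlast l)
    simp [Finsupp.single_apply, hne]
  · have hemb : ∀ l : Fin (m i), embVar ⟨i, l⟩ ≠ x := fun l => hlast' x hx l.castSucc
    have hx' : lastVar m i ≠ x := hlast' x hx _
    simp [hemb, hx', hlast' x hx w]

theorem exists_isMonicLead_of_isColorSquarefree [IsStrictTotalOrder (Var (addOne m)) prec]
    (hprec : ∀ (i : Fin d) (j k : Fin (m i + 1)), j < k → prec ⟨i, k⟩ ⟨i, j⟩)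
    (hU : IsColorSquarefreeShifted U) (h : ∀ i, IsTriangularPosition (A i) (b i))
    {a : Var (addOne m) →₀ ℕ} (ha : dropLast a ∉ U) (hsf : IsColorSquarefree (dropLast a)) :
    ∃ f : MvPolynomial (Var (addOne m)) K,
      (∀ F : ∀ i, Fin (m i + 1), tupleMonomial F ∈ U → evalTuple A F f = 0) ∧
      ∃ e ≤ a, IsMonicLead prec f e := by
  classical
  obtain ⟨F, hF⟩ : ∃ F : ∀ i, Fin (m i + 1), tupleMonomial F = dropLast a :=
    ⟨_, tupleMonomial_monomialTuple hsf⟩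
  refine ⟨∏ i with F i ≠ Fin.last (m i), ∑ w, C (b i (F i) w) * X (⟨i, w⟩ : Var (addOne m)),
    fun G hG => ?_, ∑ i with F i ≠ Fin.last (m i), Finsupp.single ⟨i, F i⟩ 1, ?_,
    IsMonicLead.prod _ fun i _ => isMonicLead_linearForm hprec h i (F i)⟩
  · have hGF : ¬ G ≤ F := fun hGF => ha (hF ▸ tupleMonomial_mem_of_le hU hG hGF)
    obtain ⟨i, hi⟩ := not_forall.1 hGF
    rw [not_le] at hi
    rw [map_prod]
    refine Finset.prod_eq_zero (i := i) ?_ ?_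
    · simpa using (hi.trans_le (Fin.le_last _)).ne
    · have hval : evalTuple A G (∑ w, C (b i (F i) w) * X (⟨i, w⟩ : Var (addOne m))) =
          C ((b i * A i) (F i) (G i)) * X i := by
        rw [map_sum, Matrix.mul_apply, map_sum, Finset.sum_mul]
        refine Finset.sum_congr rfl fun w _ => ?_
        rw [map_mul, evalTuple_X, algHom_C, algebraMap_eq, C_mul, mul_assoc]
      rw [hval, (h i).mul_apply_of_lt _ _ hi, C_0, zero_mul]
  · rintro ⟨k, l⟩
    rw [Finsupp.finsetSum_apply]
    by_cases hk : F k ≠ Fin.last (m k) ∧ F k = l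
    · obtain ⟨hk, rfl⟩ := hk
      rw [Finset.sum_eq_single k]
      · obtain ⟨j, hj⟩ := Fin.exists_castSucc_eq.2 hk
        have := DFunLike.congr_fun hF (⟨k, j⟩ : Var m)
        rw [tupleMonomial_apply, if_pos hj, dropLast_apply, embVar] at this
        dsimp only at this
        rw [hj] at this
        rw [← this, Finsupp.single_eq_same]
      · intro i _ hik
        have : (⟨i, F i⟩ : Var (addOne m)) ≠ ⟨k, F k⟩ := fun h => hik (congrArg Sigma.fst h)
        simp [this]
      · simp [hk]
    · rw [Finset.sum_eq_zero]
      · exact Nat.zero_le _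
      · intro i hi
        rw [Finsupp.single_apply, if_neg]
        intro hik
        obtain ⟨rfl, hik⟩ := Sigma.mk.inj hik
        exact hk ⟨(Finset.mem_filter.1 hi).2, eq_of_heq hik⟩

theorem exists_isMonicLead_of_not_isColorSquarefree [IsStrictTotalOrder (Var (addOne m)) prec]
    (hprec : ∀ (i : Fin d) (j k : Fin (m i + 1)), j < k → prec ⟨i, k⟩ ⟨i, j⟩)
    (h : ∀ i, IsTriangularPosition (A i) (b i))
    {a : Var (addOne m) →₀ ℕ} (hsf : ¬ IsColorSquarefree (dropLast a)) :
    ∃ f : MvPolynomial (Var (addOne m)) K,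
      (∀ F : ∀ i, Fin (m i + 1), evalTuple A F f = 0) ∧ ∃ e ≤ a, IsMonicLead prec f e := by
  classical
  obtain ⟨i, j, k, hle⟩ : ∃ (i : Fin d) (j k : Fin (m i)),
      Finsupp.single (embVar ⟨i, j⟩) 1 + Finsupp.single (embVar ⟨i, k⟩) 1 ≤ a := by
    rw [IsColorSquarefree, not_and_or] at hsf
    rcases hsf with hsf | hsf
    · obtain ⟨⟨i, j⟩, hj⟩ := not_forall.1 hsf
      refine ⟨i, j, j, fun x => ?_⟩
      rw [dropLast_apply] at hj
      by_cases hx : embVar ⟨i, j⟩ = x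
      · subst hx
        simp only [Finsupp.add_apply, Finsupp.single_eq_same]
        omega
      · simp [hx]
    · push Not at hsf
      obtain ⟨⟨i, j⟩, hj, ⟨i', k⟩, hk, hii, hjk⟩ := hsf
      obtain rfl : i = i' := hii
      rw [Finsupp.mem_support_iff, dropLast_apply] at hj hk
      have hne := embVar_injective.ne hjk
      refine ⟨i, j, k, fun x => ?_⟩
      by_cases hx : embVar ⟨i, j⟩ = x
      · subst hx
        simp only [Finsupp.add_apply, Finsupp.single_eq_same, Finsupp.single_apply, hne.symm,
          if_false]
        omega
      · by_cases hx' : embVar ⟨i, k⟩ = x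
        · subst hx'
          simp only [Finsupp.add_apply, Finsupp.single_eq_same, Finsupp.single_apply, hne,
            if_false]
          omega
        · simp [hx, hx']
  -- Any function on the columns of `A i` is the value of a linear form, and the last variable has
  -- the value `1` there.
  set y : Fin (m i + 1) → K := fun l => A i j.castSucc l * A i k.castSucc l with hy
  refine ⟨_, fun F => ?_, _, hle, isMonicLead_quadric hprec i j k (Matrix.vecMul y (A i)⁻¹)⟩
  have hsum : ∑ w, Matrix.vecMul y (A i)⁻¹ w * A i w (F i) = y (F i) := by
    change Matrix.vecMul (Matrix.vecMul y (A i)⁻¹) (A i) (F i) = y (F i)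
    rw [Matrix.vecMul_vecMul, Matrix.nonsing_inv_mul _ (h i).isUnit_det, Matrix.vecMul_one]
  simp only [map_sub, map_sum, map_mul, evalTuple_X, algHom_C, algebraMap_eq, embVar, lastVar,
    (h i).apply_last, C_1, one_mul]
  have : ∑ w, C (Matrix.vecMul y (A i)⁻¹ w) * (C (A i w (F i)) * X i * X i) =
      C (y (F i)) * (X i * X i : MvPolynomial (Fin d) K) := by
    rw [← hsum, map_sum, Finset.sum_mul]
    exact Finset.sum_congr rfl fun w _ => by rw [C_mul]; ring
  rw [this, hy, C_mul]
  ring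

/-- The value of a monomial outside `I(U)` at the points with last coordinate `1` depends only on
its tuple. -/
theorem prod_apply_pow_of_dropLast_eq (hlast : ∀ i k, A i (Fin.last (m i)) k = 1)
    {a : Var (addOne m) →₀ ℕ} {u : ∀ i, Fin (m i + 1)} (ha : dropLast a = tupleMonomial u)
    (F : ∀ i, Fin (m i + 1)) :
    ∏ v : Var (addOne m), A v.1 v.2 (F v.1) ^ a v = ∏ i, A i (u i) (F i) := by
  rw [Fintype.prod_sigma]
  refine Finset.prod_congr rfl fun i _ => ?_
  dsimp only
  rw [Fin.prod_univ_castSucc, hlast, one_pow, mul_one]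
  have : ∀ j : Fin (m i), a ⟨i, j.castSucc⟩ = if j.castSucc = u i then 1 else 0 := fun j =>
    DFunLike.congr_fun ha (⟨i, j⟩ : Var m)
  simp only [this]
  generalize u i = k
  induction k using Fin.lastCases with
  | last =>
    rw [hlast]
    exact Finset.prod_eq_one fun j _ => by rw [if_neg (Fin.castSucc_lt_last j).ne, pow_zero]
  | cast k => simp [Fin.castSucc_inj, pow_ite]

/-- The monomials outside `I(U)` are linearly independent modulo the ideal of the points. -/
theorem eq_zero_of_evalTuple_eq_zero (hU : IsColorSquarefreeShifted U)
    (h : ∀ i, IsTriangularPosition (A i) (b i)) {f : MvPolynomial (Var (addOne m)) K}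
    (hf : ∀ F : ∀ i, Fin (m i + 1), tupleMonomial F ∈ U → evalTuple A F f = 0)
    (hsupp : ∀ a ∈ f.support, dropLast a ∈ U) : f = 0 := by
  classical
  have htuple : ∀ a ∈ f.support, tupleMonomial (monomialTuple (dropLast a)) = dropLast a :=
    fun a ha => tupleMonomial_monomialTuple (hU.colorSquarefree _ (hsupp a ha))
  by_contra hne
  obtain ⟨a, ha⟩ := support_nonempty.2 hne
  set s := f.support.filter fun e => multidegree e = multidegree a with hs
  have hsf : ∀ {e}, e ∈ s → e ∈ f.support := fun he => (Finset.mem_filter.1 he).1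
  have key := eq_zero_of_sum_mul_prod_eq_zero h (T := {F | tupleMonomial F ∈ U})
    (fun F G hFG hF => tupleMonomial_mem_of_le hU hF hFG)
    (c := fun u => ∑ e ∈ s with monomialTuple (dropLast e) = u, f.coeff e) ?_ ?_
    (monomialTuple (dropLast a))
  · rw [Finset.sum_eq_single a] at key
    · exact mem_support_iff.1 ha key
    · intro e he hea
      rw [Finset.mem_filter] at he
      refine absurd (ext_of_dropLast_of_multidegree ?_ (Finset.mem_filter.1 he.1).2) hea
      rw [← htuple e (hsf he.1), he.2, htuple a ha]
    · intro hna
      rw [Finset.mem_filter, hs, Finset.mem_filter] at hna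
      exact absurd ⟨⟨ha, rfl⟩, rfl⟩ hna
  · intro u hu
    refine Finset.sum_eq_zero fun e he => absurd ?_ hu
    rw [Finset.mem_filter] at he
    change tupleMonomial u ∈ U
    rw [← he.2, htuple e (hsf he.1)]
    exact hsupp e (hsf he.1)
  · intro F hF
    have h0 := congrArg (coeff (multidegree a)) (hf F hF)
    rw [coeff_evalTuple, coeff_zero] at h0
    rw [← h0, ← Finset.sum_fiberwise s fun e => monomialTuple (dropLast e)]
    refine Finset.sum_congr rfl fun u _ => ?_
    rw [Finset.sum_mul]
    refine Finset.sum_congr rfl fun e he => ?_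
    rw [Finset.mem_filter] at he
    rw [prod_apply_pow_of_dropLast_eq (fun i => (h i).apply_last)
      (u := u) (by rw [← he.2, htuple e (hsf he.1)])]

theorem initialIdeal_eq_extend [IsStrictTotalOrder (Var (addOne m)) prec]
    (hprec : ∀ (i : Fin d) (j k : Fin (m i + 1)), j < k → prec ⟨i, k⟩ ⟨i, j⟩)
    (hU : IsColorSquarefreeShifted U) (h : ∀ i, IsTriangularPosition (A i) (b i))
    {I : Ideal (MvPolynomial (Var (addOne m)) K)}
    (hI : ∀ f, f ∈ I ↔
      ∀ F : ∀ i, Fin (m i + 1), tupleMonomial F ∈ U → evalTuple A F f = 0) :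
    initialIdeal prec I = extend (orderIdealIdeal K U) := by
  rw [extend_orderIdealIdeal_eq hU]
  refine initialIdeal_eq_span (fun a ha => ?_) fun f hf hsupp =>
    eq_zero_of_evalTuple_eq_zero hU h ((hI f).1 hf) fun a ha => not_not.1 (hsupp a ha)
  by_cases hsf : IsColorSquarefree (dropLast a)
  · obtain ⟨f, hf, hlead⟩ := exists_isMonicLead_of_isColorSquarefree hprec hU h ha hsf
    exact ⟨f, (hI f).2 hf, hlead⟩
  · obtain ⟨f, hf, hlead⟩ := exists_isMonicLead_of_not_isColorSquarefree hprec h hsf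
    exact ⟨f, (hI f).2 fun F _ => hf F, hlead⟩

end InitialIdeal

/-! ### The Zariski open sets -/

section Open

variable {K : Type*} [Field K]

/-- A matrix with nonvanishing leading principal minors has an `LU` decomposition: it becomes
unipotent lower triangular when multiplied by an upper triangular matrix. -/
theorem exists_mul_lowerTriangular {n : ℕ} (g : Matrix (Fin n) (Fin n) K)
    (hg : ∀ j : Fin n, (g.submatrix (Subtype.val : {k // k ≤ j} → Fin n) Subtype.val).det ≠ 0) :
    ∃ R : Matrix (Fin n) (Fin n) K, (∀ k j, j < k → R k j = 0) ∧
      (∀ j, (g * R) j j = 1) ∧ ∀ k j, k < j → (g * R) k j = 0 := by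
  classical
  -- The `j`-th column of `R` solves the linear system given by the `j`-th leading submatrix.
  set M : ∀ j : Fin n, Matrix {k // k ≤ j} {k // k ≤ j} K := fun j =>
    g.submatrix Subtype.val Subtype.val with hM
  set R : Matrix (Fin n) (Fin n) K := Matrix.of fun k j =>
    if hk : k ≤ j then (M j)⁻¹ ⟨k, hk⟩ ⟨j, le_rfl⟩ else 0 with hR
  have hmul : ∀ k j, k ≤ j → (g * R) k j = if k = j then 1 else 0 := fun k j hk => by
    have h1 := congrFun₂ (Matrix.mul_nonsing_inv (M j) (isUnit_iff_ne_zero.2 (hg j)))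
      ⟨k, hk⟩ ⟨j, le_rfl⟩
    rw [Matrix.one_apply, Matrix.mul_apply] at h1
    simp only [Subtype.mk.injEq] at h1
    rw [← h1, Matrix.mul_apply,
      ← Finset.sum_subset (Finset.subset_univ (Finset.univ.filter (· ≤ j))),
      Finset.sum_subtype _ (p := (· ≤ j)) (by simp)]
    · refine Finset.sum_congr rfl fun l _ => ?_
      have hl := l.2
      simp [hR, hM, hl]
    · intro l _ hl
      have hl' : ¬ l ≤ j := by simpa using hl
      simp [hR, hl']
  exact ⟨R, fun k j hkj => by simp [hR, not_le.2 hkj], fun j => by simp [hmul j j le_rfl],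
    fun k j hkj => by rw [hmul k j hkj.le, if_neg hkj.ne]⟩

/-- If the leading principal minors of `g` and the last column of `g⁻¹` do not vanish, then the
columns of `(g⁻¹)ᵀ`, scaled to have last coordinate `1`, are in triangular position. -/
theorem exists_isTriangularPosition {n : ℕ} (g : GL (Fin (n + 1)) K)
    (hg : ∀ j : Fin (n + 1), ((g : Matrix (Fin (n + 1)) (Fin (n + 1)) K).submatrix
      (Subtype.val : {k // k ≤ j} → Fin (n + 1)) Subtype.val).det ≠ 0)
    (hlast : ∀ k, (g : Matrix (Fin (n + 1)) (Fin (n + 1)) K).adjugate k (Fin.last n) ≠ 0) :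
    ∃ (b : Matrix (Fin (n + 1)) (Fin (n + 1)) K) (c : Fin (n + 1) → K), (∀ k, c k ≠ 0) ∧
      IsTriangularPosition
        ((g : Matrix (Fin (n + 1)) (Fin (n + 1)) K)⁻¹.transpose * Matrix.diagonal c) b := by
  set G : Matrix (Fin (n + 1)) (Fin (n + 1)) K := g.val with hG
  have hdet : IsUnit G.det := Matrix.isUnits_det_units g
  obtain ⟨R, hR, hL, hL'⟩ := exists_mul_lowerTriangular G hg
  have hinv : ∀ k, G⁻¹ k (Fin.last n) ≠ 0 := fun k => by
    rw [Matrix.inv_def, Matrix.smul_apply, smul_eq_mul, Ring.inverse_eq_inv']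
    exact mul_ne_zero (inv_ne_zero hdet.ne_zero) (hlast k)
  have hRdiag : ∀ k, R k k ≠ 0 := fun k => by
    have h1 : (G * R).det = 1 := by
      rw [Matrix.det_of_isLowerTriangular _ fun v w hvw => hL' v w hvw]
      simp [hL]
    rw [Matrix.det_mul, Matrix.det_of_isUpperTriangular fun v w hvw => hR v w hvw] at h1
    have h2 : ∏ k, R k k ≠ 0 := right_ne_zero_of_mul (a := G.det) (by rw [h1]; exact one_ne_zero)
    exact Finset.prod_ne_zero_iff.1 h2 k (Finset.mem_univ k)
  have hbA : ∀ v k, ((G * R).transpose * (G⁻¹.transpose *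
      Matrix.diagonal fun k => (G⁻¹ k (Fin.last n))⁻¹)) v k =
        R k v * (G⁻¹ k (Fin.last n))⁻¹ := fun v k => by
    rw [← Matrix.mul_assoc, ← Matrix.transpose_mul, Matrix.nonsing_inv_mul_cancel_left _ _ hdet,
      Matrix.mul_diagonal, Matrix.transpose_apply]
  refine ⟨(G * R).transpose, fun k => (G⁻¹ k (Fin.last n))⁻¹, fun k => inv_ne_zero (hinv k),
    fun v w hwv => hL' w v hwv, hL, fun v k hvk => ?_, fun v => ?_, fun k => ?_⟩
  · rw [hbA, hR k v hvk, zero_mul]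
  · rw [hbA]
    exact mul_ne_zero (hRdiag v) (inv_ne_zero (hinv v))
  · rw [Matrix.mul_diagonal, Matrix.transpose_apply, mul_inv_cancel₀ (hinv k)]

/-- The product of the leading principal minors and of the entries in the last column of the
adjugate of the generic matrix. -/
def genericPoly (K : Type*) [Field K] (n : ℕ) :
    MvPolynomial (Fin (n + 1) × Fin (n + 1)) K :=
  (∏ j : Fin (n + 1), ((Matrix.mvPolynomialX (Fin (n + 1)) (Fin (n + 1)) K).submatrix
      (Subtype.val : {k // k ≤ j} → Fin (n + 1)) Subtype.val).det) *
    ∏ k, (Matrix.mvPolynomialX (Fin (n + 1)) (Fin (n + 1)) K).adjugate k (Fin.last n)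

theorem eval_genericPoly {n : ℕ} (g : Matrix (Fin (n + 1)) (Fin (n + 1)) K) :
    eval (fun e => g e.1 e.2) (genericPoly K n) =
      (∏ j : Fin (n + 1), (g.submatrix
        (Subtype.val : {k // k ≤ j} → Fin (n + 1)) Subtype.val).det) *
          ∏ k, g.adjugate k (Fin.last n) := by
  rw [genericPoly, map_mul, map_prod, map_prod]
  congr 1
  · refine Finset.prod_congr rfl fun j _ => ?_
    rw [RingHom.map_det]
    congr 1
    ext k l
    simp
  · refine Finset.prod_congr rfl fun k _ => ?_
    have h1 := RingHom.map_adjugate (eval fun e => g e.1 e.2)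
      (Matrix.mvPolynomialX (Fin (n + 1)) (Fin (n + 1)) K)
    rw [Matrix.mvPolynomialX_mapMatrix_eval] at h1
    rw [← h1]
    rfl

theorem exists_eval_genericPoly_ne_zero (n : ℕ) :
    ∃ g : GL (Fin (n + 1)) K,
      eval (fun e => (g : Matrix (Fin (n + 1)) (Fin (n + 1)) K) e.1 e.2) (genericPoly K n) ≠ 0 := by
  classical
  -- The inverse of `g` is the identity matrix with the last column replaced by ones.
  set N : Matrix (Fin (n + 1)) (Fin (n + 1)) K :=
    Matrix.of fun k l => if l = Fin.last n ∧ k ≠ Fin.last n then 1 else 0 with hN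
  have hNN : N * N = 0 := by
    ext k l
    rw [Matrix.mul_apply]
    refine Finset.sum_eq_zero fun x _ => ?_
    by_cases hx : x = Fin.last n <;> simp [hN, hx]
  have hmul : (1 - N) * (1 + N) = 1 := by
    rw [sub_mul, mul_add, mul_add, hNN]
    simp
  have hmul' : (1 + N) * (1 - N) = 1 := by
    rw [add_mul, mul_sub, mul_sub, hNN]
    simp
  have htri : ∀ k l : Fin (n + 1), l < k → (1 - N) k l = 0 := fun k l hlk => by
    have hl : l ≠ Fin.last n := (hlk.trans_le (Fin.le_last k)).ne
    simp [hN, Matrix.one_apply_ne hlk.ne', hl]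
  have hdiag : ∀ k : Fin (n + 1), (1 - N) k k = 1 := fun k => by simp [hN]
  have hdet : (1 - N).det = 1 := by
    rw [Matrix.det_of_isUpperTriangular fun v w hvw => htri v w hvw]
    simp only [hdiag, Finset.prod_const_one]
  have hadj : (1 - N).adjugate = 1 + N := by
    have h1 := congrArg (fun B => (1 + N) * B) (Matrix.mul_adjugate (1 - N))
    rwa [← Matrix.mul_assoc, hmul', hdet, one_smul, Matrix.one_mul, Matrix.mul_one] at h1
  refine ⟨⟨1 - N, 1 + N, hmul, hmul'⟩, ?_⟩
  rw [eval_genericPoly]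
  refine mul_ne_zero (Finset.prod_ne_zero_iff.2 fun j _ => ?_)
    (Finset.prod_ne_zero_iff.2 fun k _ => ?_)
  · change ((1 - N).submatrix (Subtype.val : {k // k ≤ j} → Fin (n + 1)) Subtype.val).det ≠ 0
    have hsub : ((1 - N).submatrix (Subtype.val : {k // k ≤ j} → Fin (n + 1))
        Subtype.val).IsUpperTriangular := fun v w hvw => htri v w hvw
    rw [Matrix.det_of_isUpperTriangular hsub]
    simp only [Matrix.submatrix_apply, hdiag, Finset.prod_const_one]
    exact one_ne_zero
  · change (1 - N).adjugate k (Fin.last n) ≠ 0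
    rw [hadj]
    by_cases hk : k = Fin.last n
    · simp [hk, hN]
    · simp [hN, hk, Matrix.one_apply_ne hk]

/-- Over an infinite field, the general linear group is irreducible in the Zariski topology. -/
theorem IsZariskiOpen.inter_nonempty [Infinite K] {n : ℕ} {W W' : Set (GL (Fin n) K)}
    (hW : IsZariskiOpen W) (hne : W.Nonempty) (hW' : IsZariskiOpen W') (hne' : W'.Nonempty) :
    (W ∩ W').Nonempty := by
  obtain ⟨S, rfl⟩ := hW
  obtain ⟨S', rfl⟩ := hW'
  obtain ⟨g, p, hp, hgp⟩ := hne
  obtain ⟨g', p', hp', hgp'⟩ := hne'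
  have hp0 : p ≠ 0 := by
    rintro rfl
    simp at hgp
  have hp0' : p' ≠ 0 := by
    rintro rfl
    simp at hgp'
  have hne : p * p' * (Matrix.mvPolynomialX (Fin n) (Fin n) K).det ≠ 0 :=
    mul_ne_zero (mul_ne_zero hp0 hp0') (Matrix.det_mvPolynomialX_ne_zero (Fin n) K)
  obtain ⟨x, hx⟩ : ∃ x, eval x (p * p' * (Matrix.mvPolynomialX (Fin n) (Fin n) K).det) ≠ 0 := by
    by_contra! h
    exact hne (MvPolynomial.funext fun x => by rw [h x, map_zero])
  rw [map_mul, map_mul, RingHom.map_det] at hx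
  set M : Matrix (Fin n) (Fin n) K := Matrix.of fun i j => x (i, j) with hM
  have hMx : (eval x).mapMatrix (Matrix.mvPolynomialX (Fin n) (Fin n) K) = M := by
    ext i j
    simp [hM]
  rw [hMx] at hx
  refine ⟨Matrix.GeneralLinearGroup.mkOfDetNeZero M (right_ne_zero_of_mul hx),
    ⟨p, hp, ?_⟩, ⟨p', hp', ?_⟩⟩
  · exact left_ne_zero_of_mul (left_ne_zero_of_mul hx)
  · exact right_ne_zero_of_mul (left_ne_zero_of_mul hx)

/-- Multigraded generic initial ideals are unique over infinite fields. -/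
theorem IsMultigradedGin.unique [Infinite K] {d : ℕ} {n : Fin d → ℕ}
    {prec : Var n → Var n → Prop} {I J J' : Ideal (MvPolynomial (Var n) K)}
    (h : IsMultigradedGin prec I J) (h' : IsMultigradedGin prec I J') : J = J' := by
  obtain ⟨W, hW, hJ⟩ := h
  obtain ⟨W', hW', hJ'⟩ := h'
  choose g hg hg' using fun i => (hW i).1.inter_nonempty (hW i).2 (hW' i).1 (hW' i).2
  rw [← hJ g hg, ← hJ' g hg']

end Open

theorem isMultigradedGin_extend {K : Type*} [Field K] {d : ℕ} {m : Fin d → ℕ}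
    {prec : Var (addOne m) → Var (addOne m) → Prop} [IsStrictTotalOrder (Var (addOne m)) prec]
    (hprec : ∀ (i : Fin d) (j k : Fin (m i + 1)), j < k → prec ⟨i, k⟩ ⟨i, j⟩)
    {U : Set (Var m →₀ ℕ)} (hU : IsColorSquarefreeShifted U) :
    IsMultigradedGin prec (stanleyReisnerIdeal K (balancedComplex U))
      (extend (orderIdealIdeal K U)) := by
  refine ⟨fun i => {g | ∃ p ∈ ({genericPoly K (m i)} : Set _),
    eval (fun e => (g : Matrix (Fin (m i + 1)) (Fin (m i + 1)) K) e.1 e.2) p ≠ 0},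
    fun i => ⟨⟨_, rfl⟩, ?_⟩, fun g hg => ?_⟩
  · obtain ⟨g, hg⟩ := exists_eval_genericPoly_ne_zero (K := K) (m i)
    exact ⟨g, _, rfl, hg⟩
  · have htri : ∀ i, ∃ (b : Matrix (Fin (m i + 1)) (Fin (m i + 1)) K) (c : Fin (m i + 1) → K),
        (∀ k, c k ≠ 0) ∧ IsTriangularPosition
          ((g i : Matrix (Fin (m i + 1)) (Fin (m i + 1)) K)⁻¹.transpose *
            Matrix.diagonal c) b := fun i => by
      obtain ⟨p, hp, hgp⟩ := hg i
      obtain rfl : p = genericPoly K (m i) := hp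
      rw [eval_genericPoly] at hgp
      exact exists_isTriangularPosition (g i)
        (fun j => Finset.prod_ne_zero_iff.1 (left_ne_zero_of_mul hgp) j (Finset.mem_univ j))
        (fun k => Finset.prod_ne_zero_iff.1 (right_ne_zero_of_mul hgp) k (Finset.mem_univ k))
    choose b c hc h using htri
    exact initialIdeal_eq_extend hprec hU h fun f =>
      mem_map_colorAction_stanleyReisnerIdeal_iff hU hc g f

end BalancedSqueezed

end

open BalancedSqueezed
theorem theorem4p2 {K : Type*} [Field K] [Infinite K] {d : ℕ} (m : Fin d → ℕ)
    (prec : Var (addOne m) → Var (addOne m) → Prop) [IsStrictTotalOrder (Var (addOne m)) prec]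
    (hprec : ∀ (i : Fin d) (j k : Fin (m i + 1)), j < k → prec ⟨i, k⟩ ⟨i, j⟩)
    (U : Set (Var m →₀ ℕ)) (hU : IsColorSquarefreeShifted U) :
    (∀ J : Ideal (MvPolynomial (Var (addOne m)) K),
      IsMultigradedGin prec (stanleyReisnerIdeal K (balancedComplex U)) J ↔
        J = extend (orderIdealIdeal K U)) ∧
      IsStronglyColorStable (extend (orderIdealIdeal K U)) := by
  refine ⟨fun J => ⟨fun hJ => hJ.unique (isMultigradedGin_extend hprec hU), ?_⟩,
    isStronglyColorStable_extend hU⟩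
  rintro rfl
  exact isMultigradedGin_extend hprec hU
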